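/- Let $p$ be a prime, let $K$ be a field of characteristic $p$, let $n \ge 0$, and let $d_0 \ge d_1 \ge \cdots \ge d_n \ge 2$ be integers. Put $R = K[x_0,\ldots,x_n]$ with its standard grading, $I_{\mathbf d} = (x_0^{d_0}, x_1^{d_1}, \ldots, x_n^{d_n})$, and let $t = d_0 + \cdots + d_n - (n+1)$ be the socle degree of $A = R/I_{\mathbf d}$. The graded algebra $A$ is said to have the strong Lefschetz property if there is a linear form $\ell \in [A]_1$ such that, for all integers $j \ge 0$ and $k \ge 1$, the multiplication map $\times \ell^k : [A]_j \to [A]_{j+k}$ has maximal rank, that is, is injective or surjective. 1. If $\max\{d_1,\, 2d_0 - t\} \le p \le d_0$, or if $d_0 \le p^m \le t$ for some integer $m \ge 1$, then $R/I_{\mathbf d}$ does not have the strong Lefschetz property. (If $n = 0$, there is no $d_1$; the first condition is then read with $d_0$ in place of $d_1$, and it never holds since $2d_0 - t = d_0 + 1$.) 2. If $p > t$, then $R/I_{\mathbf d}$ has the strong Lefschetz property. -/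

import Mathlib

open MvPolynomial

namespace Lefschetz

noncomputable section

/-- The `K`-subspace `[A]_j` of `A = K[x_i : i ∈ σ] / I` of classes of homogeneous polynomials of
degree `j`. For a homogeneous ideal `I` this is the degree `j` component of the standard grading. -/
def gradedPiece {σ K : Type*} [Field K] (I : Ideal (MvPolynomial σ K)) (j : ℕ) :
    Submodule K (MvPolynomial σ K ⧸ I) :=
  (homogeneousSubmodule σ K j).map (Ideal.Quotient.mkₐ K I).toLinearMap

theorem pow_mul_mem_gradedPiece {σ K : Type*} [Field K] {I : Ideal (MvPolynomial σ K)}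
    {l : MvPolynomial σ K ⧸ I} (hl : l ∈ gradedPiece I 1) (j k : ℕ)
    (a : MvPolynomial σ K ⧸ I) (ha : a ∈ gradedPiece I j) :
    LinearMap.mulLeft K (l ^ k) a ∈ gradedPiece I (j + k) := by
  obtain ⟨f, hf, rfl⟩ := hl
  obtain ⟨g, hg, rfl⟩ := ha
  refine ⟨f ^ k * g, ?_, by simp⟩
  have h : (f ^ k * g).IsHomogeneous (1 * k + j) :=
    (IsHomogeneous.pow ((mem_homogeneousSubmodule 1 f).mp hf) k).mul
      ((mem_homogeneousSubmodule j g).mp hg)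
  rw [one_mul, add_comm] at h
  exact (mem_homogeneousSubmodule (j + k) _).mpr h

/-- The multiplication map `×ℓ^k : [A]_j → [A]_{j+k}` of a linear form `ℓ ∈ [A]_1`. -/
def mulPow {σ K : Type*} [Field K] (I : Ideal (MvPolynomial σ K))
    (l : MvPolynomial σ K ⧸ I) (hl : l ∈ gradedPiece I 1) (j k : ℕ) :
    gradedPiece I j →ₗ[K] gradedPiece I (j + k) :=
  (LinearMap.mulLeft K (l ^ k)).restrict (pow_mul_mem_gradedPiece hl j k)

/-- A linear map has maximal rank if it is injective or surjective; between finite-dimensional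
spaces this says that its rank is the smaller of the two dimensions. -/
def HasMaximalRank {K V W : Type*} [Field K] [AddCommGroup V] [Module K V]
    [AddCommGroup W] [Module K W] (f : V →ₗ[K] W) : Prop :=
  Function.Injective f ∨ Function.Surjective f

/-- The linear form `l` is a strong Lefschetz element of `K[x_i : i ∈ σ] / I`. -/
def IsStrongLefschetzElement {σ K : Type*} [Field K] (I : Ideal (MvPolynomial σ K))
    (l : MvPolynomial σ K ⧸ I) : Prop :=
  ∃ hl : l ∈ gradedPiece I 1, ∀ j k : ℕ, 1 ≤ k → HasMaximalRank (mulPow I l hl j k)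

/-- The algebra `K[x_i : i ∈ σ] / I` has the strong Lefschetz property. -/
def HasStrongLefschetzProperty {σ K : Type*} [Field K] (I : Ideal (MvPolynomial σ K)) : Prop :=
  ∃ l : MvPolynomial σ K ⧸ I, IsStrongLefschetzElement I l

/-- The ideal `I_d = (x_0 ^ d_0, …, x_n ^ d_n)` of `K[x_0, …, x_n]`. -/
def monomialCI (K : Type*) [Field K] {n : ℕ} (d : Fin (n + 1) → ℕ) :
    Ideal (MvPolynomial (Fin (n + 1)) K) :=
  Ideal.span (Set.range fun i => (X i : MvPolynomial (Fin (n + 1)) K) ^ d i)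

end

end Lefschetz

namespace Lefschetz

/-! If `p > t`, the sum `L` of the variables is a strong Lefschetz element by `𝔰𝔩₂`-theory: the
operator `lowering`, here `F`, preserves the ideal, and `FL - LF` acts on degree `j` as `t - 2j`.
Only integers in `1, …, t` need inverting. Injectivity for `2j + k ≤ t` is
`mem_powIdeal_of_sumX_pow_mul_mem`; surjectivity otherwise is `exists_sub_sumX_pow_mul_mem`.

The negative part is Frobenius: for `q = p ^ m`, `l ^ q` is a combination of the `x_j ^ q`, and
modulo the ideal only `c x_0 ^ q` survives. It kills monomials `u` with `u_0 + q ≥ d_0` and misses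
monomials `v` with `v_0 < q`; if both occur in the right degrees, the rank is not maximal. -/

theorem mem_of_natCast_mul_mem {σ K : Type*} [Field K]
    {I : Ideal (MvPolynomial σ K)} {c : ℕ} (hc : (c : K) ≠ 0)
    {f : MvPolynomial σ K} (h : (c : MvPolynomial σ K) * f ∈ I) : f ∈ I := by
  have h1 : f = C ((c : K)⁻¹) * ((c : MvPolynomial σ K) * f) := by
    rw [← mul_assoc, ← map_natCast (C : K →+* MvPolynomial σ K) c, ← C_mul, inv_mul_cancel₀ hc,
      C_1, one_mul]
  rw [h1]
  exact Ideal.mul_mem_left _ _ h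

/-! ### The `𝔰𝔩₂`-action -/

section Lowering

variable {σ K : Type*} [Fintype σ] [Field K] (d : σ → ℕ)

/-- The ideal `(x_i ^ d_i : i ∈ σ)`. -/
noncomputable def powIdeal (K : Type*) [Field K] (d : σ → ℕ) : Ideal (MvPolynomial σ K) :=
  Ideal.span (Set.range fun i => (X i : MvPolynomial σ K) ^ d i)

/-- The lowering operator of the `𝔰𝔩₂`-action on `K[x_i : i ∈ σ]` whose raising operator is
multiplication by the sum of the variables and which descends to the quotient by the ideal
`(x_i ^ d_i : i ∈ σ)`. It sends `x_i ^ k` to `k (d_i - k) x_i ^ (k - 1)`. -/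
noncomputable def lowering (K : Type*) [Field K] (d : σ → ℕ) :
    MvPolynomial σ K →ₗ[K] MvPolynomial σ K :=
  ∑ i, ((d i : K) • (pderiv i).toLinearMap -
    (pderiv i).toLinearMap ∘ₗ LinearMap.mulLeft K (X i) ∘ₗ (pderiv i).toLinearMap)

theorem lowering_apply (f : MvPolynomial σ K) :
    lowering K d f = ∑ i, ((d i : MvPolynomial σ K) * pderiv i f -
      pderiv i (X i * pderiv i f)) := by
  simp [lowering, LinearMap.sum_apply, MvPolynomial.smul_eq_C_mul]

theorem lowering_isHomogeneous {f : MvPolynomial σ K} {j : ℕ} (hf : f.IsHomogeneous (j + 1)) :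
    (lowering K d f).IsHomogeneous j := by
  rw [lowering_apply]
  refine IsHomogeneous.sum _ _ _ fun i _ => ?_
  have h1 : (pderiv i f).IsHomogeneous j := hf.pderiv
  refine IsHomogeneous.sub ?_ ?_
  · have := (isHomogeneous_C σ (d i : K)).mul h1
    simpa using this
  · have h2 : (X i * pderiv i f).IsHomogeneous (1 + j) := (isHomogeneous_X K i).mul h1
    have h3 := h2.pderiv (i := i)
    rwa [Nat.add_sub_cancel_left] at h3

theorem lowering_eq_zero {f : MvPolynomial σ K} (hf : f.IsHomogeneous 0) :
    lowering K d f = 0 := by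
  rw [← totalDegree_zero_iff_isHomogeneous, totalDegree_eq_zero_iff_eq_C] at hf
  rw [hf, lowering_apply]
  simp

/-- The sum of the variables. -/
noncomputable def sumX (σ K : Type*) [Fintype σ] [Field K] : MvPolynomial σ K := ∑ i, X i

theorem sumX_isHomogeneous : (sumX σ K).IsHomogeneous 1 :=
  IsHomogeneous.sum _ _ _ fun i _ => isHomogeneous_X K i

theorem pderiv_sumX (i : σ) : pderiv i (sumX σ K) = 1 := by
  classical
  simp [sumX, pderiv_X, Pi.single_apply]

variable {d} {t : ℕ}

/-- In each variable the commutator is `(d_i - 1) - 2 x_i ∂_i`; Euler's identity sums these. -/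
theorem lowering_sumX_mul (ht : t + Fintype.card σ = ∑ i, d i) {f : MvPolynomial σ K} {j : ℕ}
    (hf : f.IsHomogeneous j) :
    lowering K d (sumX σ K * f) =
      sumX σ K * lowering K d f + ((t : MvPolynomial σ K) - 2 * j) * f := by
  have he := hf.sum_X_mul_pderiv
  rw [nsmul_eq_mul] at he
  have ht' : (t : MvPolynomial σ K) = ∑ i : σ, ((d i : MvPolynomial σ K) - 1) := by
    rw [Finset.sum_sub_distrib, ← Nat.cast_sum, ← ht]
    simp
  rw [sub_mul, mul_assoc, ← he, ht', lowering_apply, lowering_apply, Finset.mul_sum,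
    Finset.mul_sum, Finset.sum_mul, ← Finset.sum_sub_distrib, ← Finset.sum_add_distrib]
  refine Finset.sum_congr rfl fun i _ => ?_
  simp only [pderiv_mul, pderiv_sumX, pderiv_X_self, map_add, pderiv_one]
  ring

theorem lowering_sumX_pow_mul (ht : t + Fintype.card σ = ∑ i, d i) {f : MvPolynomial σ K} {j : ℕ}
    (hf : f.IsHomogeneous j) (k : ℕ) :
    lowering K d (sumX σ K ^ (k + 1) * f) = sumX σ K ^ (k + 1) * lowering K d f +
      (k + 1) * ((t : MvPolynomial σ K) - 2 * j - k) * (sumX σ K ^ k * f) := by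
  induction k with
  | zero => simpa using lowering_sumX_mul ht hf
  | succ k ih =>
    have h : (sumX σ K ^ (k + 1) * f).IsHomogeneous (1 * (k + 1) + j) :=
      (sumX_isHomogeneous.pow _).mul hf
    have h2 := lowering_sumX_mul ht h
    rw [pow_succ' _ (k + 1), mul_assoc, h2, ih]
    push_cast
    ring

/-- The coefficient `k (d_i - k)` vanishes at `k = d_i`, so no multiple of `x_i ^ d_i` is lowered
out of the ideal. -/
theorem lowering_mem {f : MvPolynomial σ K} (hf : f ∈ powIdeal K d) :
    lowering K d f ∈ powIdeal K d := by
  obtain ⟨c, rfl⟩ := Ideal.mem_span_range_iff_exists_fun.mp hf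
  rw [map_sum]
  refine sum_mem fun j _ => ?_
  rw [lowering_apply]
  refine sum_mem fun i _ => ?_
  have hj : (X j : MvPolynomial σ K) ^ d j ∈ powIdeal K d := Ideal.subset_span ⟨j, rfl⟩
  by_cases hij : i = j
  · subst hij
    have hX : (X i : MvPolynomial σ K) * pderiv i (X i ^ d i) =
        (d i : MvPolynomial σ K) * X i ^ d i := by
      rw [pderiv_pow, pderiv_X_self]
      cases d i with
      | zero => simp
      | succ m => simp; ring
    have h1 : X i * pderiv i (c i * X i ^ d i) =
        (X i * pderiv i (c i)) * X i ^ d i + (d i : MvPolynomial σ K) * (c i * X i ^ d i) := by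
      rw [pderiv_mul]
      linear_combination c i * hX
    have h2 : pderiv i ((d i : MvPolynomial σ K)) = 0 := by
      simp
    rw [h1, map_add, pderiv_mul (f := (d i : MvPolynomial σ K)), h2,
      pderiv_mul (f := X i * pderiv i (c i))]
    have h3 : (d i : MvPolynomial σ K) * pderiv i (c i * X i ^ d i) -
        (pderiv i (X i * pderiv i (c i)) * X i ^ d i +
          X i * pderiv i (c i) * pderiv i (X i ^ d i) +
        (0 * (c i * X i ^ d i) + (d i : MvPolynomial σ K) * pderiv i (c i * X i ^ d i))) =
        (-pderiv i (X i * pderiv i (c i)) - pderiv i (c i) * (d i : MvPolynomial σ K)) * X i ^ d i := by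
      linear_combination -(pderiv i (c i)) * hX
    rw [h3]
    exact Ideal.mul_mem_left _ _ hj
  · have h0 : pderiv i ((X j : MvPolynomial σ K) ^ d j) = 0 := by
      rw [pderiv_pow, pderiv_X_of_ne (Ne.symm hij), mul_zero]
    rw [pderiv_mul, h0, mul_zero, add_zero, ← mul_assoc, ← mul_assoc, pderiv_mul, h0, mul_zero,
      add_zero, ← sub_mul]
    exact Ideal.mul_mem_left _ _ hj

/-- The primitive case: modulo the ideal `F L ^ (k + 1) f = (k + 1)(t - 2j - k) L ^ k f` with an
invertible scalar, so powers of `L` peel off one at a time. -/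
theorem mem_of_lowering_mem (ht : t + Fintype.card σ = ∑ i, d i)
    (hK : ∀ c : ℕ, 0 < c → c ≤ t → (c : K) ≠ 0) {j : ℕ} {f : MvPolynomial σ K}
    (hf : f.IsHomogeneous j) (hF : lowering K d f ∈ powIdeal K d) {k : ℕ} (hk : 2 * j + k ≤ t)
    (h : sumX σ K ^ k * f ∈ powIdeal K d) : f ∈ powIdeal K d := by
  induction k with
  | zero => simpa using h
  | succ k ih =>
    obtain ⟨e, rfl⟩ : ∃ e, t = 2 * j + k + (e + 1) :=
      ⟨t - (2 * j + k + 1), by omega⟩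
    refine ih (by omega) ?_
    have h1 := lowering_sumX_pow_mul ht hf k
    refine mem_of_natCast_mul_mem (c := (k + 1) * (e + 1)) ?_ ?_
    · push_cast
      refine mul_ne_zero ?_ ?_
      · exact_mod_cast hK (k + 1) (by omega) (by omega)
      · exact_mod_cast hK (e + 1) (by omega) (by omega)
    · have h2 : (((k + 1) * (e + 1) : ℕ) : MvPolynomial σ K) * (sumX σ K ^ k * f) =
          lowering K d (sumX σ K ^ (k + 1) * f) - sumX σ K ^ (k + 1) * lowering K d f := by
        rw [h1]
        push_cast
        ring
      rw [h2]
      exact sub_mem (lowering_mem h) (Ideal.mul_mem_left _ _ hF)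

/-- The commutator formula turns `L ^ k f ∈ I` into `L ^ (k + 1) F f ∈ I`. Induction on the degree
then gives `F f ∈ I`, the primitive case. -/
theorem mem_powIdeal_of_sumX_pow_mul_mem (ht : t + Fintype.card σ = ∑ i, d i)
    (hK : ∀ c : ℕ, 0 < c → c ≤ t → (c : K) ≠ 0) {j k : ℕ} {f : MvPolynomial σ K}
    (hk : 2 * j + k ≤ t) (hf : f.IsHomogeneous j) (h : sumX σ K ^ k * f ∈ powIdeal K d) :
    f ∈ powIdeal K d := by
  induction j generalizing k f with
  | zero => exact mem_of_lowering_mem ht hK hf (by simp [lowering_eq_zero d hf]) hk h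
  | succ j ihj =>
    refine mem_of_lowering_mem ht hK hf ?_ hk h
    refine ihj (k := k + 1) (by omega) (lowering_isHomogeneous d hf) ?_
    have h1 := lowering_sumX_pow_mul ht hf k
    rw [eq_comm, ← eq_sub_iff_add_eq] at h1
    rw [h1]
    refine sub_mem (lowering_mem ?_) (Ideal.mul_mem_left _ _ h)
    rw [pow_succ', mul_assoc]
    exact Ideal.mul_mem_left _ _ h

theorem lowering_iterate_isHomogeneous {r : ℕ} (i : ℕ) {g : MvPolynomial σ K}
    (hg : g.IsHomogeneous (r + i)) : ((lowering K d)^[i] g).IsHomogeneous r := by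
  induction i generalizing r with
  | zero => simpa using hg
  | succ i ih =>
    rw [Function.iterate_succ_apply']
    exact lowering_isHomogeneous d (ih (by rwa [add_assoc, add_comm 1 i]))

theorem sumX_mul_lowering_iterate (ht : t + Fintype.card σ = ∑ i, d i) {m : ℕ}
    {g : MvPolynomial σ K} (hg : g.IsHomogeneous m) (hLg : sumX σ K * g ∈ powIdeal K d) {i : ℕ}
    (hi : i ≤ m) :
    sumX σ K * (lowering K d)^[i + 1] g -
      ((i : MvPolynomial σ K) + 1) * (2 * (m : MvPolynomial σ K) - t - i) * (lowering K d)^[i] g ∈ powIdeal K d := by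
  induction i with
  | zero =>
    have h1 := lowering_sumX_mul ht hg
    have h2 := lowering_mem hLg
    rw [h1] at h2
    convert h2 using 1
    simp
    ring
  | succ i ih =>
    obtain ⟨r, rfl⟩ : ∃ r, m = r + (i + 1) := ⟨m - (i + 1), by omega⟩
    have h1 := lowering_sumX_mul ht (lowering_iterate_isHomogeneous (d := d) (i + 1) hg)
    have h2 := lowering_mem (ih (by omega))
    -- The scalar is written as a constant so that `K`-linearity of `lowering` applies.
    have h3 : ((i : MvPolynomial σ K) + 1) *
          (2 * ((r + (i + 1) : ℕ) : MvPolynomial σ K) - t - i) =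
        (C (((i : K) + 1) * (2 * ((r + (i + 1) : ℕ) : K) - t - i)) : MvPolynomial σ K) := by
      have hC : (C 2 : MvPolynomial σ K) = 2 := map_ofNat C 2
      simp [hC]
    rw [map_sub, h1, h3, ← MvPolynomial.smul_eq_C_mul, map_smul, MvPolynomial.smul_eq_C_mul, ← h3,
      ← Function.iterate_succ_apply' (lowering K d), ← Function.iterate_succ_apply' (lowering K d)]
      at h2
    convert h2 using 1
    push_cast
    ring

/-- A class killed by `L` is recovered, up to a unit, from `L ^ k F ^ k`, hence is divisible by `L ^
k`. -/
theorem exists_sumX_pow_mul_lowering_iterate (ht : t + Fintype.card σ = ∑ i, d i)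
    (hK : ∀ c : ℕ, 0 < c → c ≤ t → (c : K) ≠ 0) {m : ℕ} (hmt : m ≤ t)
    {g : MvPolynomial σ K} (hg : g.IsHomogeneous m) (hLg : sumX σ K * g ∈ powIdeal K d) {k : ℕ}
    (hkm : k ≤ m) (hk : t + k ≤ 2 * m) :
    ∃ u : ℕ, (u : K) ≠ 0 ∧
      sumX σ K ^ k * (lowering K d)^[k] g - (u : MvPolynomial σ K) * g ∈ powIdeal K d := by
  induction k with
  | zero => exact ⟨1, by simp, by simp⟩
  | succ k ih =>
    obtain ⟨u, hu, h⟩ := ih (by omega) (by omega)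
    obtain ⟨e, he⟩ : ∃ e, 2 * m = t + k + (e + 1) := ⟨2 * m - (t + k + 1), by omega⟩
    refine ⟨(k + 1) * (e + 1) * u, ?_, ?_⟩
    · push_cast
      refine mul_ne_zero (mul_ne_zero ?_ ?_) hu
      · exact_mod_cast hK (k + 1) (by omega) (by omega)
      · exact_mod_cast hK (e + 1) (by omega) (by omega)
    · have h1 := sumX_mul_lowering_iterate ht hg hLg (i := k) (by omega)
      have he' : 2 * (m : MvPolynomial σ K) = t + k + (e + 1) := by
        simpa using congrArg (Nat.cast : ℕ → MvPolynomial σ K) he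
      rw [he'] at h1
      convert add_mem (Ideal.mul_mem_left _ (sumX σ K ^ k) h1)
        (Ideal.mul_mem_left _ ((k + 1) * (e + 1) : MvPolynomial σ K) h) using 1
      push_cast
      ring

end Lowering

/-! ### Monomials in the ideal, and surjectivity -/

section PowIdeal

variable {σ K : Type*} [Field K] {d : σ → ℕ}

theorem mem_powIdeal_iff {f : MvPolynomial σ K} :
    f ∈ powIdeal K d ↔ ∀ m ∈ f.support, ∃ i, d i ≤ m i := by
  have h : (Set.range fun i => (X i : MvPolynomial σ K) ^ d i) =
      (fun s => monomial s (1 : K)) '' (Set.range fun i => Finsupp.single i (d i)) := by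
    rw [← Set.range_comp]
    congr 1
    ext1 i
    simp [X_pow_eq_monomial]
  rw [powIdeal, h, mem_ideal_span_monomial_image]
  simp

theorem monomial_mem_powIdeal_iff {m : σ →₀ ℕ} :
    monomial m (1 : K) ∈ powIdeal K d ↔ ∃ i, d i ≤ m i := by
  classical
  rw [mem_powIdeal_iff, support_monomial]
  simp

variable [Fintype σ] {t : ℕ}

theorem mem_powIdeal_of_lt (ht : t + Fintype.card σ = ∑ i, d i) {f : MvPolynomial σ K} {m : ℕ}
    (hf : f.IsHomogeneous m) (hm : t < m) : f ∈ powIdeal K d := by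
  rw [mem_powIdeal_iff]
  intro s hs
  by_contra! h
  have h1 : s.degree = m := by
    have := hf (mem_support_iff.mp hs)
    rwa [Finsupp.degree_eq_weight_one]
  rw [Finsupp.degree_eq_sum] at h1
  have h2 : ∑ i, (s i + 1) ≤ ∑ i, d i := Finset.sum_le_sum fun i _ => h i
  rw [Finset.sum_add_distrib, ← ht] at h2
  simp at h2
  omega

/-- Descending induction on the degree `j + k`, trivial above `t`. A preimage `h` of `L g` under `L
^ (k + 1)` leaves `g - L ^ k h` killed by `L`, hence itself divisible by `L ^ k`. -/
theorem exists_sub_sumX_pow_mul_mem (ht : t + Fintype.card σ = ∑ i, d i)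
    (hK : ∀ c : ℕ, 0 < c → c ≤ t → (c : K) ≠ 0) {j k : ℕ} {g : MvPolynomial σ K}
    (hk : t ≤ 2 * j + k) (hg : g.IsHomogeneous (j + k)) :
    ∃ h : MvPolynomial σ K, h.IsHomogeneous j ∧ g - sumX σ K ^ k * h ∈ powIdeal K d := by
  by_cases hjk : t < j + k
  · exact ⟨0, isHomogeneous_zero .., by simpa using mem_powIdeal_of_lt ht hg hjk⟩
  induction hN : t + 1 - (j + k) generalizing k g with
  | zero => omega
  | succ N ih =>
    have hLg : (sumX σ K * g).IsHomogeneous (j + (k + 1)) := by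
      have := (sumX_isHomogeneous (σ := σ) (K := K)).mul hg
      rwa [add_comm 1, add_assoc] at this
    obtain ⟨h, hh, hL⟩ : ∃ h : MvPolynomial σ K, h.IsHomogeneous j ∧
        sumX σ K * g - sumX σ K ^ (k + 1) * h ∈ powIdeal K d := by
      by_cases hjk' : t < j + (k + 1)
      · exact ⟨0, isHomogeneous_zero .., by simpa using mem_powIdeal_of_lt ht hLg hjk'⟩
      · exact ih (by omega) hLg hjk' (by omega)
    have hg' : (g - sumX σ K ^ k * h).IsHomogeneous (j + k) := by
      refine hg.sub ?_
      have := (sumX_isHomogeneous (σ := σ) (K := K)).pow k |>.mul hh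
      rwa [one_mul, add_comm] at this
    have hLg' : sumX σ K * (g - sumX σ K ^ k * h) ∈ powIdeal K d := by
      convert hL using 1
      ring
    obtain ⟨u, hu, h'⟩ := exists_sumX_pow_mul_lowering_iterate ht hK (by omega) hg' hLg'
      (k := k) (by omega) (by omega)
    have hu' : (u : MvPolynomial σ K) * C ((u : K)⁻¹) = 1 := by
      rw [← map_natCast (C : K →+* MvPolynomial σ K) u, ← C_mul, mul_inv_cancel₀ hu, C_1]
    refine ⟨h + C ((u : K)⁻¹) * (lowering K d)^[k] (g - sumX σ K ^ k * h), hh.add ?_, ?_⟩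
    · have := (isHomogeneous_C σ ((u : K)⁻¹)).mul
        (lowering_iterate_isHomogeneous (d := d) k hg')
      rwa [zero_add] at this
    · convert Ideal.mul_mem_left _ (-C ((u : K)⁻¹)) h' using 1
      linear_combination (-(g - sumX σ K ^ k * h)) * hu'

end PowIdeal

/-! ### The Lefschetz criterion and the Frobenius obstruction -/

section StrongLefschetz

variable {σ K : Type*} [Field K] {d : σ → ℕ}

theorem isStrongLefschetzElement_sumX [Fintype σ] {t : ℕ} (ht : t + Fintype.card σ = ∑ i, d i)
    (hK : ∀ c : ℕ, 0 < c → c ≤ t → (c : K) ≠ 0) :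
    IsStrongLefschetzElement (powIdeal K d) (Ideal.Quotient.mk _ (sumX σ K)) := by
  refine ⟨⟨sumX σ K, sumX_isHomogeneous, rfl⟩, fun j k _ => ?_⟩
  by_cases hjk : 2 * j + k ≤ t
  · left
    rw [← LinearMap.ker_eq_bot, LinearMap.ker_eq_bot']
    rintro ⟨_, f, hf, rfl⟩ h
    have h1 : Ideal.Quotient.mk (powIdeal K d) (sumX σ K ^ k * f) = 0 := by
      simpa [mulPow] using congrArg Subtype.val h
    rw [Ideal.Quotient.eq_zero_iff_mem] at h1
    have h2 := mem_powIdeal_of_sumX_pow_mul_mem ht hK hjk hf h1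
    ext
    exact Ideal.Quotient.eq_zero_iff_mem.mpr h2
  · right
    rintro ⟨_, g, hg, rfl⟩
    obtain ⟨h, hh, hm⟩ := exists_sub_sumX_pow_mul_mem ht hK (by omega) hg
    refine ⟨⟨_, h, hh, rfl⟩, ?_⟩
    ext
    have := (Ideal.Quotient.mk_eq_mk_iff_sub_mem _ _).mpr hm
    simpa [mulPow] using this.symm

theorem not_hasMaximalRank_mulPow {l : MvPolynomial σ K} {i : σ} {q : ℕ}
    {c : K} (hlq : l ^ q - C c * X i ^ q ∈ powIdeal K d) {u v : σ →₀ ℕ}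
    (hu : ∀ i, u i < d i) (huq : d i ≤ u i + q) (hv : ∀ i, v i < d i) (hvq : v i < q)
    (huv : v.degree = u.degree + q)
    (hl' : Ideal.Quotient.mk (powIdeal K d) l ∈ gradedPiece (powIdeal K d) 1) :
    ¬ HasMaximalRank (mulPow (powIdeal K d) _ hl' u.degree q) := by
  classical
  rintro (h | h)
  · have hm : monomial u (1 : K) ∈ powIdeal K d := by
      have h0 : (⟨Ideal.Quotient.mk _ (monomial u 1), monomial u 1,
          isHomogeneous_monomial _ rfl, rfl⟩ : gradedPiece (powIdeal K d) u.degree) = 0 := by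
        apply h
        rw [map_zero]
        ext
        have h1 : l ^ q * monomial u 1 ∈ powIdeal K d := by
          have h2 : X i ^ q * monomial u (1 : K) ∈ powIdeal K d := by
            rw [X_pow_eq_monomial, monomial_mul, one_mul, monomial_mem_powIdeal_iff]
            exact ⟨i, by simpa [add_comm] using huq⟩
          convert add_mem (Ideal.mul_mem_right (monomial u 1) _ hlq)
            (Ideal.mul_mem_left _ (C c) h2) using 1
          ring
        simpa [mulPow] using Ideal.Quotient.eq_zero_iff_mem.mpr h1
      exact Ideal.Quotient.eq_zero_iff_mem.mp (congrArg Subtype.val h0)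
    obtain ⟨j, hj⟩ := monomial_mem_powIdeal_iff.mp hm
    exact absurd (hu j) (by omega)
  · obtain ⟨⟨_, w, hw, rfl⟩, hwv⟩ := h ⟨Ideal.Quotient.mk _ (monomial v 1), monomial v 1,
      isHomogeneous_monomial _ huv, rfl⟩
    have h1 : Ideal.Quotient.mk (powIdeal K d) (l ^ q * w) =
        Ideal.Quotient.mk (powIdeal K d) (monomial v 1) := by
      simpa [mulPow] using congrArg Subtype.val hwv
    have h2 : C c * w * X i ^ q - monomial v 1 ∈ powIdeal K d := by
      convert sub_mem ((Ideal.Quotient.mk_eq_mk_iff_sub_mem _ _).mp h1)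
        (Ideal.mul_mem_right w _ hlq) using 1
      ring
    obtain ⟨j, hj⟩ := mem_powIdeal_iff.mp h2 v (by
      rw [mem_support_iff, coeff_sub, X_pow_eq_monomial, coeff_mul_monomial', if_neg]
      · simp
      · intro hle
        have := hle i
        simp at this
        omega)
    exact absurd (hv j) (by omega)

theorem exists_pow_sub_C_mul_X_pow_mem [Fintype σ] (p : ℕ) [Fact p.Prime] [CharP K p]
    {l : MvPolynomial σ K} (hl : l.IsHomogeneous 1) (i : σ) (m : ℕ)
    (hd : ∀ j, j ≠ i → d j ≤ p ^ m) :
    ∃ c : K, l ^ p ^ m - C c * X i ^ p ^ m ∈ powIdeal K d := by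
  classical
  have h : l ∈ Submodule.span K (Set.range X) := by
    rw [← homogeneousSubmodule_one_eq_span_X]
    exact hl
  obtain ⟨a, rfl⟩ := Submodule.mem_span_range_iff_exists_fun K |>.mp h
  refine ⟨a i ^ p ^ m, ?_⟩
  rw [sum_pow_char_pow, ← Finset.add_sum_erase _ _ (Finset.mem_univ i), MvPolynomial.smul_eq_C_mul,
    mul_pow, C_pow, add_sub_cancel_left]
  refine sum_mem fun j hj => ?_
  rw [MvPolynomial.smul_eq_C_mul, mul_pow]
  have hX : (X j : MvPolynomial σ K) ^ d j ∈ powIdeal K d := Ideal.subset_span ⟨j, rfl⟩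
  exact Ideal.mul_mem_left _ _ (Ideal.mem_of_dvd _ (pow_dvd_pow _ (hd j (Finset.ne_of_mem_erase hj))) hX)

theorem not_hasStrongLefschetzProperty [Fintype σ] (p : ℕ) [Fact p.Prime] [CharP K p]
    (i : σ) (m : ℕ) (hd : ∀ j, j ≠ i → d j ≤ p ^ m) {u v : σ →₀ ℕ}
    (hu : ∀ j, u j < d j) (hui : d i ≤ u i + p ^ m) (hv : ∀ j, v j < d j) (hvi : v i < p ^ m)
    (huv : v.degree = u.degree + p ^ m) : ¬ HasStrongLefschetzProperty (powIdeal K d) := by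
  rintro ⟨_, ⟨l, hl, rfl⟩, h⟩
  obtain ⟨c, hc⟩ := exists_pow_sub_C_mul_X_pow_mem p hl i m hd
  exact not_hasMaximalRank_mulPow hc hu hui hv hvi huv _
    (h u.degree (p ^ m) (Nat.one_le_pow _ _ (Fact.out : p.Prime).pos))

end StrongLefschetz

theorem exists_le_degree_eq_of_le_sum {σ : Type*} [Fintype σ] (b : σ → ℕ) {e : ℕ}
    (he : e ≤ ∑ i, b i) : ∃ v : σ →₀ ℕ, (∀ i, v i ≤ b i) ∧ v.degree = e := by
  obtain ⟨v, hv, hve⟩ := Finsupp.exists_le_degree_eq (Finsupp.equivFunOnFinite.symm b) e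
    (by simpa [Finsupp.degree_eq_sum] using he)
  exact ⟨v, fun i => hv i, hve⟩

end Lefschetz

theorem theorem3p5 {K : Type*} [Field K] (p : ℕ) (hp : p.Prime) [CharP K p]
    (n : ℕ) (d : Fin (n + 1) → ℕ) (hd : Antitone d) (hd2 : ∀ i, 2 ≤ d i)
    (t : ℕ) (ht : (t : ℤ) = (∑ i, (d i : ℤ)) - (n + 1)) :
    (((max (d 1 : ℤ) (2 * (d 0 : ℤ) - t) ≤ p ∧ p ≤ d 0) ∨
        (∃ m : ℕ, 1 ≤ m ∧ d 0 ≤ p ^ m ∧ p ^ m ≤ t)) →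
      ¬ Lefschetz.HasStrongLefschetzProperty (Lefschetz.monomialCI K d)) ∧
    (t < p → Lefschetz.HasStrongLefschetzProperty (Lefschetz.monomialCI K d)) := by
  have := Fact.mk hp
  have ht' : t + (n + 1) = ∑ i, d i := by zify; omega
  have hs : ∑ i, (d i - 1) = t := by
    have : ∑ i, (d i - 1) + ∑ i : Fin (n + 1), 1 = ∑ i, d i := by
      rw [← Finset.sum_add_distrib]
      exact Finset.sum_congr rfl fun i _ => Nat.sub_add_cancel (by have := hd2 i; omega)
    simp at this
    omega
  have hs0 : d 0 - 1 + ∑ i : Fin n, (d i.succ - 1) = t := by rw [← hs, Fin.sum_univ_succ]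
  refine ⟨?_, fun h => ⟨_, Lefschetz.isStrongLefschetzElement_sumX (t := t) (by simpa using ht') ?_⟩⟩
  · rintro (⟨h1, h2⟩ | ⟨m, -, h1, h2⟩)
    · rw [max_le_iff] at h1
      -- Source `x_0 ^ (d_0 - p)`, target degree `d_0`. A monomial `v` with `v_0 ≤ p - 1` exists
      -- there because `(p - 1) + (t - (d_0 - 1)) ≥ d_0`, that is, `p ≥ 2 d_0 - t`.
      obtain ⟨v, hv, hve⟩ := Lefschetz.exists_le_degree_eq_of_le_sum
        (Fin.cons (p - 1) fun i : Fin n => d i.succ - 1 : Fin (n + 1) → ℕ) (e := d 0) (by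
          rw [Fin.sum_univ_succ]
          simp
          have := hp.pos
          have := hd2 0
          omega)
      have hv0 : v 0 ≤ p - 1 := hv 0
      have := hp.pos
      refine Lefschetz.not_hasStrongLefschetzProperty p 0 1 (u := Finsupp.single 0 (d 0 - p)) (v := v)
        ?_ ?_ ?_ ?_ ?_ ?_
      · intro j hj
        rw [pow_one]
        have h3 : d j ≤ d 1 := hd <| by
          rw [Fin.le_iff_val_le_val]
          have : (j : ℕ) ≠ 0 := fun h => hj (Fin.ext h)
          cases n with
          | zero => omega
          | succ n => simp; omega
        omega
      · intro j
        by_cases hj : j = 0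
        · subst hj
          simp
          omega
        · rw [Finsupp.single_eq_of_ne hj]
          have := hd2 j
          omega
      · simp
        omega
      · intro j
        cases j using Fin.cases with
        | zero => omega
        | succ j =>
          have h3 : v j.succ ≤ d j.succ - 1 := hv j.succ
          have := hd2 j.succ
          omega
      · rw [pow_one]
        omega
      · rw [Finsupp.degree_single, pow_one]
        omega
    -- Here `l ^ (p ^ m)` already kills `1`, while degree `p ^ m ≤ t` contains a nonzero monomial.
    · obtain ⟨v, hv, hve⟩ := Lefschetz.exists_le_degree_eq_of_le_sum (fun i => d i - 1)
        (e := p ^ m) (by omega)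
      have hv' : ∀ j, v j < d j := fun j => by
        have := hv j
        have := hd2 j
        omega
      refine Lefschetz.not_hasStrongLefschetzProperty p 0 m (u := 0) (v := v)
        (fun j _ => (hd (Fin.zero_le j)).trans h1) ?_ ?_ hv' ?_ ?_
      · intro j
        have := hd2 j
        simp
        omega
      · simpa using h1
      · have := hv' 0
        omega
      · simpa using hve
  · intro c hc hct h0
    have := Nat.le_of_dvd hc ((CharP.cast_eq_zero_iff K p c).mp h0)
    omega
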